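/- Let $R$ be a finite associative ring with nonzero identity, not necessarily commutative, and let $J(R)$ be its Jacobson radical. The unit graph of $R$ is the simple graph with vertex set $R$ in which two distinct elements $x, y$ are adjacent if and only if $x + y$ is a unit of $R$. A graph is well-covered if all its maximal (with respect to inclusion) independent sets have the same size. Then the unit graph of $R$ is well-covered if and only if at least one of the following holds: (1) $R/J(R)$ is isomorphic, as a ring, to one of $F$, $F \times F$ or $M_2(F)$ for some finite field $F$ of characteristic $2$; (2) $R/J(R)$ is isomorphic, as a ring, to $\mathbb{Z}_2^k$ for some integer $k \ge 1$, where $\mathbb{Z}_2 = \mathbb{Z}/2\mathbb{Z}$. -/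

import Mathlib

universe u

/-- The unit graph of a ring `R`: the vertices are the elements of `R`, and two distinct vertices
`x`, `y` are adjacent if and only if `x + y` is a unit of `R`. -/
def unitGraph (R : Type*) [Ring R] : SimpleGraph R where
  Adj x y := x ≠ y ∧ IsUnit (x + y)
  symm := ⟨fun x y h => ⟨h.1.symm, by rw [add_comm]; exact h.2⟩⟩
  loopless := ⟨fun _ h => h.1 rfl⟩

/-- A graph is well-covered if all its (inclusion-)maximal independent sets have the same size. -/
def SimpleGraph.IsWellCovered {V : Type*} (G : SimpleGraph V) : Prop :=
  ∀ S T : Set V, Maximal G.IsIndepSet S → Maximal G.IsIndepSet T → S.encard = T.encard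

open Matrix

/-! ### Maximal independent sets, parity under negation, reduction modulo the radical -/

section UnitGraph

variable {R S : Type*} [Ring R] [Ring S]

/-! For necessity, maximal independent sets of different sizes are produced in every ring off the
list. If 2 is a unit, sets closed under negation do this: one contains 0 and is odd, another omits 0
and is even (`not_isWellCovered_of_isUnit_two`). In general R/J is a product of matrix rings M_d(D)
over finite fields. The field K of order |D|^d embeds in M_d(D) through its multiplication on K ≅
D^d, and evaluation at the vector of 1 is a retraction onto K that vanishes on no unit. In any
characteristic its kernel pulls back to a maximal independent set of index |K| in R. So
well-coveredness makes all the numbers |D|^d equal, and characteristic 2 in one factor forces it in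
all.

In characteristic 2, well-coveredness is the same for R and R/J, and the diagonal copy of K is a
clique whose order times that of the kernel is the order of the ring. Equality in this
clique-coclique bound makes every maximal independent set meet K, so an independent set that no
element of K extends refutes well-coveredness (`FieldRetract.not_isWellCovered`). Such sets exist
for three factors with |K| > 2, for two factors one of which has d ≥ 2, and for one factor with d ≥
3.

For sufficiency, the maximal independent sets of each listed ring are described outright. -/

theorem unitGraph_isIndepSet_iff {M : Set R} :
    (unitGraph R).IsIndepSet M ↔ ∀ x ∈ M, ∀ y ∈ M, x ≠ y → ¬IsUnit (x + y) := by
  simp only [SimpleGraph.isIndepSet_iff, Set.Pairwise, unitGraph, not_and]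
  exact ⟨fun h x hx y hy hxy => h hx hy hxy hxy, fun h x hx y hy hxy _ => h x hx y hy hxy⟩

theorem unitGraph_maximal_isIndepSet_iff {M : Set R} :
    Maximal (unitGraph R).IsIndepSet M ↔
      (∀ x ∈ M, ∀ y ∈ M, x ≠ y → ¬IsUnit (x + y)) ∧ ∀ y ∉ M, ∃ x ∈ M, IsUnit (x + y) := by
  constructor
  · intro h
    refine ⟨unitGraph_isIndepSet_iff.1 h.prop, fun y hy => ?_⟩
    by_contra! hc
    refine hy (h.le_of_ge (y := insert y M) ?_ (Set.subset_insert _ _) (Set.mem_insert _ _))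
    rw [unitGraph_isIndepSet_iff]
    rintro a (rfl | ha) b (rfl | hb) hab
    · exact absurd rfl hab
    · rw [add_comm]
      exact hc b hb
    · exact hc a ha
    · exact unitGraph_isIndepSet_iff.1 h.prop a ha b hb hab
  · rintro ⟨h1, h2⟩
    refine ⟨unitGraph_isIndepSet_iff.2 h1, fun N hN hMN y hy => ?_⟩
    by_contra hyM
    obtain ⟨x, hx, hu⟩ := h2 y hyM
    exact unitGraph_isIndepSet_iff.1 hN x (hMN hx) y hy (fun e => hyM (e ▸ hx)) hu

theorem exists_maximal_isIndepSet_of_subset [Finite R] {I : Set R}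
    (hI : ∀ x ∈ I, ∀ y ∈ I, x ≠ y → ¬IsUnit (x + y)) :
    ∃ M, I ⊆ M ∧ Maximal (unitGraph R).IsIndepSet M :=
  (Set.toFinite {M : Set R | (unitGraph R).IsIndepSet M}).exists_le_maximal
    (unitGraph_isIndepSet_iff.2 hI)

/-- Maximal independent sets may be chosen closed under negation. -/
theorem exists_neg_closed_maximal_isIndepSet [Finite R] [Nontrivial R] (a : R)
    (ha : ∀ x ∈ ({a, -a} : Set R), ∀ y ∈ ({a, -a} : Set R), x ≠ y → ¬IsUnit (x + y)) :
    ∃ M, a ∈ M ∧ (∀ x ∈ M, -x ∈ M) ∧ Maximal (unitGraph R).IsIndepSet M := by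
  obtain ⟨M, hsub, hM⟩ := (Set.toFinite {M : Set R | (∀ x ∈ M, -x ∈ M) ∧
    ∀ x ∈ M, ∀ y ∈ M, x ≠ y → ¬IsUnit (x + y)}).exists_le_maximal (a := {a, -a}) (by
      refine ⟨?_, ha⟩
      rintro x (rfl | rfl) <;> simp)
  obtain ⟨hneg, hind⟩ := hM.prop
  refine ⟨M, hsub (by simp), hneg, unitGraph_maximal_isIndepSet_iff.2 ⟨hind, fun y hy => ?_⟩⟩
  by_contra! hc
  have hc' : ∀ x ∈ M, ¬IsUnit (x + -y) := fun x hx h => hc (-x) (hneg x hx) (by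
    rw [← IsUnit.neg_iff]
    simpa [add_comm] using h)
  have hyy : ¬IsUnit (y + -y) := by simp
  -- Adjoining `y` and `-y` together keeps the set closed under negation, so maximality among closed
  -- sets already gives maximality among all.
  refine hy (hM.le_of_ge (y := insert y (insert (-y) M)) ⟨?_, ?_⟩ (fun x hx => ?_) (by simp))
  · rintro x (rfl | rfl | hx)
    · simp
    · simp
    · simp [hneg x hx]
  · rintro b (rfl | rfl | hb) c (rfl | rfl | hc1) hbc
    · exact absurd rfl hbc
    · exact hyy
    · rw [add_comm]; exact hc c hc1
    · rwa [add_comm]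
    · exact absurd rfl hbc
    · rw [add_comm]; exact hc' c hc1
    · exact hc b hb
    · exact hc' b hb
    · exact hind b hb c hc1 hbc
  · exact Or.inr (Or.inr hx)

theorem even_ncard_of_neg_closed [Finite R] (h2 : ∀ x : R, x = -x → x = 0) {M : Set R}
    (hneg : ∀ x ∈ M, -x ∈ M) (h0 : (0 : R) ∉ M) : Even M.ncard := by
  classical
  have := Fintype.ofFinite R
  rw [Set.ncard_eq_toFinset_card', even_iff_two_dvd, ← CharP.cast_eq_zero_iff (ZMod 2) 2,
    Finset.cast_card]
  refine Finset.sum_involution (fun x _ => -x) (fun _ _ => by decide) (fun x hx _ he => ?_)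
    (fun x hx => ?_) (fun _ _ => neg_neg _)
  · rw [Set.mem_toFinset] at hx
    exact h0 (h2 x he.symm ▸ hx)
  · rw [Set.mem_toFinset] at hx ⊢
    exact hneg x hx

/-- If `2` is invertible, some maximal independent set has odd size and some has even size. -/
theorem not_isWellCovered_of_isUnit_two [Finite R] [Nontrivial R] (h2 : IsUnit (2 : R)) :
    ¬(unitGraph R).IsWellCovered := by
  have hself : ∀ x : R, x = -x → x = 0 := fun x hx => by
    have : (2 : R) * x = 0 := by rw [two_mul]; nth_rewrite 1 [hx]; simp
    exact h2.mul_right_eq_zero.1 this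
  obtain ⟨M, h0M, hMneg, hM⟩ := exists_neg_closed_maximal_isIndepSet (0 : R) (by simp)
  obtain ⟨N, h1N, hNneg, hN⟩ := exists_neg_closed_maximal_isIndepSet (1 : R) (by simp)
  intro h
  have hcard : M.ncard = N.ncard := congrArg ENat.toNat (h M N hM hN)
  -- 0 and 1 are adjacent, so `N` omits 0 and is even; `M` is 0 together with pairs `x`, `-x`, hence
  -- odd.
  have hN0 : (0 : R) ∉ N := fun h0 =>
    unitGraph_isIndepSet_iff.1 hN.prop 1 h1N 0 h0 one_ne_zero (by simp)
  have e1 := even_ncard_of_neg_closed hself hNneg hN0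
  have e2 := even_ncard_of_neg_closed hself (M := M \ {0})
    (fun x hx => ⟨hMneg x hx.1, by simpa using hx.2⟩) (by simp)
  have := Set.ncard_sdiff_singleton_add_one h0M
  rw [← hcard, ← this] at e1
  exact (Nat.even_add_one.1 e1) e2

/-- An additive subgroup of nonunits that no element can be added to is a maximal
independent set. -/
theorem maximal_isIndepSet_addSubgroup (L : AddSubgroup R) (hL : ∀ x ∈ L, ¬IsUnit x)
    (h : ∀ y ∉ L, ∃ x ∈ L, IsUnit (x + y)) :
    Maximal (unitGraph R).IsIndepSet (L : Set R) :=
  unitGraph_maximal_isIndepSet_iff.2 ⟨fun _ hx _ hy _ => hL _ (L.add_mem hx hy), h⟩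

/-- Lifting maximal independent sets along a surjective local homomorphism. -/
theorem maximal_isIndepSet_preimage (f : R →+* S) (hf : Function.Surjective f) [IsLocalHom f]
    (h2 : ∀ x : S, x + x = 0) [Nontrivial S] {M : Set S} :
    Maximal (unitGraph S).IsIndepSet M → Maximal (unitGraph R).IsIndepSet (f ⁻¹' M) := by
  simp only [unitGraph_maximal_isIndepSet_iff]
  rintro ⟨h1, h3⟩
  refine ⟨fun x hx y hy _ hu => ?_, fun y hy => ?_⟩
  -- Elements of one fibre have a sum mapping to `2 • f x = 0`, so fibres are independent.
  · have hu' := hu.map f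
    rw [map_add] at hu'
    refine h1 _ hx _ hy (fun e => ?_) hu'
    rw [e, h2] at hu'
    exact not_isUnit_zero hu'
  · obtain ⟨x, hx, hu⟩ := h3 _ hy
    obtain ⟨x, rfl⟩ := hf x
    rw [← map_add] at hu
    exact ⟨x, hx, (isUnit_map_iff f _).1 hu⟩

/-- Adjacency depends only on images under `f`, so elements of one fibre are nonadjacent twins and a
maximal independent set is a union of fibres. -/
theorem exists_preimage_eq_of_maximal_isIndepSet (f : R →+* S) (hf : Function.Surjective f)
    [IsLocalHom f] (h2 : ∀ x : S, x + x = 0) [Nontrivial S] {M : Set R}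
    (hM : Maximal (unitGraph R).IsIndepSet M) :
    ∃ N, Maximal (unitGraph S).IsIndepSet N ∧ M = f ⁻¹' N := by
  rw [unitGraph_maximal_isIndepSet_iff] at hM
  obtain ⟨h1, h3⟩ := hM
  have hne : ∀ x y : R, IsUnit (x + y) → x ≠ y := by
    rintro x y hu rfl
    have := hu.map f
    rw [map_add, h2] at this
    exact not_isUnit_zero this
  have hMf : M = f ⁻¹' (f '' M) := by
    refine (Set.subset_preimage_image f M).antisymm fun y hy => ?_
    obtain ⟨m, hm, he⟩ := hy
    by_contra hyM
    obtain ⟨x, hx, hu⟩ := h3 y hyM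
    have : IsUnit (x + m) := by
      rw [← isUnit_map_iff f, map_add, he, ← map_add, isUnit_map_iff f]
      exact hu
    exact h1 x hx m hm (hne _ _ this) this
  refine ⟨f '' M, unitGraph_maximal_isIndepSet_iff.2 ⟨?_, fun y hy => ?_⟩, hMf⟩
  · rintro _ ⟨x, hx, rfl⟩ _ ⟨y, hy, rfl⟩ hxy hu
    rw [← map_add, isUnit_map_iff f] at hu
    exact h1 x hx y hy (fun e => hxy (e ▸ rfl)) hu
  · obtain ⟨y, rfl⟩ := hf y
    obtain ⟨x, hx, hu⟩ := h3 y (fun h => hy ⟨y, h, rfl⟩)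
    exact ⟨f x, ⟨x, hx, rfl⟩, by rw [← map_add]; exact hu.map f⟩

theorem ncard_preimage_of_surjective (f : R →+* S) (hf : Function.Surjective f) [Finite R]
    (N : Set S) : (f ⁻¹' N).ncard = N.ncard * Nat.card f.toAddMonoidHom.ker := by
  choose g hg using hf
  rw [← Nat.card_coe_set_eq, ← Nat.card_coe_set_eq, ← Nat.card_prod]
  refine Nat.card_congr ⟨fun x => (⟨f x, x.2⟩, ⟨x - g (f x), ?_⟩), fun y => ⟨y.2 + g y.1, ?_⟩,
    fun x => ?_, fun y => ?_⟩
  · simp [AddMonoidHom.mem_ker, hg]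
  · have := y.2.2
    simp only [AddMonoidHom.mem_ker, RingHom.toAddMonoidHom_eq_coe, AddMonoidHom.coe_coe] at this
    simp [hg, this]
  · simp
  · have := y.2.2
    simp only [AddMonoidHom.mem_ker, RingHom.toAddMonoidHom_eq_coe, AddMonoidHom.coe_coe] at this
    ext <;> simp [hg, this]

theorem isWellCovered_iff_ncard [Finite R] : (unitGraph R).IsWellCovered ↔
    ∀ M N : Set R, Maximal (unitGraph R).IsIndepSet M → Maximal (unitGraph R).IsIndepSet N →
      M.ncard = N.ncard := by
  refine forall₄_congr fun M N _ _ => ?_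
  rw [← (Set.toFinite M).cast_ncard_eq, ← (Set.toFinite N).cast_ncard_eq, Nat.cast_inj]

theorem isWellCovered_iff_of_surjective (f : R →+* S) (hf : Function.Surjective f) [IsLocalHom f]
    (h2 : ∀ x : S, x + x = 0) [Nontrivial S] [Finite R] :
    (unitGraph R).IsWellCovered ↔ (unitGraph S).IsWellCovered := by
  have : Finite S := Finite.of_surjective f hf
  simp only [isWellCovered_iff_ncard]
  constructor
  · intro h M N hM hN
    have := h _ _ (maximal_isIndepSet_preimage f hf h2 hM) (maximal_isIndepSet_preimage f hf h2 hN)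
    rw [ncard_preimage_of_surjective f hf, ncard_preimage_of_surjective f hf] at this
    exact Nat.eq_of_mul_eq_mul_right Nat.card_pos this
  · intro h M N hM hN
    obtain ⟨M', hM', rfl⟩ := exists_preimage_eq_of_maximal_isIndepSet f hf h2 hM
    obtain ⟨N', hN', rfl⟩ := exists_preimage_eq_of_maximal_isIndepSet f hf h2 hN
    rw [ncard_preimage_of_surjective f hf, ncard_preimage_of_surjective f hf, h M' N' hM' hN']

/-- An element left invertible modulo the radical lies in no maximal left ideal, hence has a left
inverse in `R`; finiteness makes it a unit. -/
theorem isLocalHom_mk_jacobson [Finite R] : IsLocalHom (Ideal.Quotient.mk (Ring.jacobson R)) := by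
  refine ⟨fun x hx => ?_⟩
  obtain ⟨y, hy⟩ := hx.exists_left_inv
  obtain ⟨y, rfl⟩ := Ideal.Quotient.mk_surjective y
  rw [← map_mul, ← map_one (Ideal.Quotient.mk _), Ideal.Quotient.eq] at hy
  have htop : Ideal.span {x} = ⊤ := by
    by_contra hne
    obtain ⟨m, hm, hle⟩ := Ideal.exists_le_maximal _ hne
    refine hm.ne_top ((Ideal.eq_top_iff_one m).2 ?_)
    have h1 := Ring.jacobson_le_of_isMaximal m hy
    have h2 : y * x ∈ m := m.mul_mem_left y (hle (Ideal.mem_span_singleton_self x))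
    simpa using m.sub_mem h2 h1
  obtain ⟨z, hz⟩ := Ideal.mem_span_singleton'.1 ((Ideal.eq_top_iff_one _).1 htop)
  exact IsUnit.of_mul_eq_one_right z hz

end UnitGraph

/-! ### Field retracts and the clique-coclique criterion -/

/-- A field `K` inside a ring `A` with an additive retraction `A → K` that vanishes on no unit. -/
structure FieldRetract (K A : Type*) [Field K] [Ring A] where
  sec : K →+* A
  ret : A →+ K
  ret_sec : ∀ c, ret (sec c) = c
  not_isUnit : ∀ x, ret x = 0 → ¬IsUnit x

namespace FieldRetract

variable {K A : Type*} [Field K] [Ring A] (r : FieldRetract K A)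

theorem isUnit_sec {c : K} (hc : c ≠ 0) : IsUnit (r.sec c) :=
  (IsUnit.mk0 c hc).map r.sec

theorem nontrivial (r : FieldRetract K A) : Nontrivial A := by
  by_contra h
  rw [not_nontrivial_iff_subsingleton] at h
  exact r.not_isUnit 0 (map_zero _) (isUnit_of_subsingleton _)

/-- The retract onto `K` embedded diagonally in a product, using the retraction of factor `i`. -/
def pi {ι : Type*} {A : ι → Type*} [∀ i, Ring (A i)] (r : ∀ i, FieldRetract K (A i)) (i : ι) :
    FieldRetract K (∀ i, A i) where
  sec := RingHom.pi fun j => (r j).sec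
  ret := (r i).ret.comp (Pi.evalAddMonoidHom A i)
  ret_sec c := (r i).ret_sec c
  not_isUnit x hx hu := (r i).not_isUnit (x i) hx (hu.map (Pi.evalRingHom A i))

theorem isUnit_add_sec_sec (h2 : ∀ x : A, x + x = 0) {c d : K} (h : c ≠ d) :
    IsUnit (r.sec c + r.sec d) := by
  rw [← map_add]
  refine r.isUnit_sec fun e => h ?_
  have hd : d + d = 0 := by
    rw [← r.ret_sec (d + d), map_add, h2, map_zero]
  exact add_right_cancel (e.trans hd.symm)

/-- The criterion for failure of well-coveredness in characteristic two: an independent set that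
no element of the embedded field extends. -/
theorem not_isWellCovered [Finite A] (h2 : ∀ x : A, x + x = 0) {I : Set A}
    (hI : ∀ x ∈ I, ∀ y ∈ I, x ≠ y → ¬IsUnit (x + y)) (h : ∀ c, ∃ x ∈ I, IsUnit (x + r.sec c)) :
    ¬(unitGraph A).IsWellCovered := by
  have := r.nontrivial
  have : Finite K := Finite.of_injective r.sec r.sec.injective
  rw [isWellCovered_iff_ncard]
  intro hwc
  obtain ⟨M, hIM, hM⟩ := exists_maximal_isIndepSet_of_subset hI
  have hL : Maximal (unitGraph A).IsIndepSet (r.ret.ker : Set A) := by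
    refine maximal_isIndepSet_addSubgroup _ (fun x hx => r.not_isUnit x hx) fun y hy => ?_
    refine ⟨r.sec (r.ret y) - y, ?_, ?_⟩
    · simp [AddMonoidHom.mem_ker, r.ret_sec]
    · rw [sub_add_cancel]
      exact r.isUnit_sec hy
  have hML := hwc M _ hM hL
  rw [unitGraph_maximal_isIndepSet_iff] at hM
  have hLcard : (r.ret.ker : Set A).ncard * Nat.card K = Nat.card A := by
    rw [← Nat.card_coe_set_eq, ← Nat.card_prod]
    refine Nat.card_congr ⟨fun x => x.1 + r.sec x.2,
      fun y => (⟨y - r.sec (r.ret y), ?_⟩, r.ret y), fun x => ?_, fun y => ?_⟩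
    · simp [AddMonoidHom.mem_ker, r.ret_sec]
    · have : r.ret x.1 = 0 := x.1.2
      ext <;> simp [this, r.ret_sec]
    · simp
  -- If `m + c = n + d` with `c ≠ d`, then `m + n = c + d` is a unit, against independence; so `g`
  -- is injective. If `g` took the value 0, then `M` would contain some `r.sec c`, which is adjacent
  -- to a member of `I`. Hence `|M| |K| < |A|`.
  let g : M × K → A := fun x => x.1 + r.sec x.2
  have hne : ∀ x y : A, IsUnit (x + y) → x ≠ y := by
    rintro x y hu rfl
    rw [h2] at hu
    exact not_isUnit_zero hu
  have heq : ∀ a b c d : A, a + b = c + d → a + c = b + d := fun a b c d e => by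
    have e1 : a + c = (a + b) + (c + b) - (b + b) := by abel
    have e2 : b + d = (c + d) + (c + b) - (c + c) := by abel
    rw [e1, e2, e, h2, h2]
  have hginj : Function.Injective g := by
    rintro ⟨⟨m, hm⟩, c⟩ ⟨⟨n, hn⟩, d⟩ e
    simp only [g] at e
    by_cases hcd : c = d
    · subst hcd
      simpa using e
    · exfalso
      have hu := r.isUnit_add_sec_sec h2 hcd
      rw [← heq _ _ _ _ e] at hu
      exact hM.1 m hm n hn (hne _ _ hu) hu
  have hg0 : ∀ x, g x ≠ 0 := by
    rintro ⟨⟨m, hm⟩, c⟩ e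
    simp only [g] at e
    obtain ⟨x, hx, hu⟩ := h c
    have hmc : m = r.sec c := add_right_cancel (e.trans (h2 _).symm)
    rw [← hmc] at hu
    exact hM.1 x (hIM hx) m hm (hne _ _ hu) hu
  have hlt : Nat.card (M × K) < Nat.card A := by
    have := Fintype.ofFinite A
    have := Fintype.ofFinite (M × K)
    rw [Nat.card_eq_fintype_card, Nat.card_eq_fintype_card]
    exact Fintype.card_lt_of_injective_of_notMem g hginj (b := 0) (by simpa using hg0)
  rw [Nat.card_prod, Nat.card_coe_set_eq, hML, hLcard] at hlt
  exact lt_irrefl _ hlt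

/-- A retract of the full matrix ring over `F` onto the field extension of degree `n`. -/
theorem nonempty_matrix {F K : Type*} [Field F] [Finite F] [Field K] {n : ℕ} [NeZero n]
    (hK : Nat.card K = Nat.card F ^ n) : Nonempty (FieldRetract K (Matrix (Fin n) (Fin n) F)) := by
  obtain ⟨p, hp⟩ := CharP.exists F
  have : Fact p.Prime := ⟨CharP.char_is_prime F p⟩
  let E := FiniteField.Extension F p n
  have : Finite K := Nat.finite_of_card_ne_zero (hK ▸ pow_ne_zero _ Nat.card_pos.ne')
  have := Fintype.ofFinite K
  have := Fintype.ofFinite E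
  let e : K ≃+* E := FiniteField.ringEquivOfCardEq (by
    rw [Fintype.card_eq_nat_card, Fintype.card_eq_nat_card, hK, FiniteField.natCard_extension])
  let b : Module.Basis (Fin n) F E :=
    Module.finBasisOfFinrankEq F E (FiniteField.finrank_extension F p n)
  -- The retraction is `x ↦ x *ᵥ v` read in `K`; multiplication by `c` sends 1 to `c`, and an
  -- invertible matrix does not kill `v`.
  let v : Fin n → F := b.repr 1
  have hv : v ≠ 0 := fun h => one_ne_zero (b.repr.map_eq_zero_iff.1 (DFunLike.coe_injective h))
  refine ⟨⟨(Algebra.leftMulMatrix b : E →+* _).comp e.toRingHom,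
    { toFun := fun x => e.symm (b.equivFun.symm (x *ᵥ v))
      map_zero' := by simp
      map_add' := fun x y => by rw [add_mulVec, map_add, map_add] }, fun c => ?_, fun x hx hu => ?_⟩⟩
  · have : Algebra.leftMulMatrix b (e c) *ᵥ v = b.equivFun (e c) := by
      simp only [v, Algebra.leftMulMatrix_mulVec_repr, mul_one]
      rfl
    simp only [AddMonoidHom.coe_mk, ZeroHom.coe_mk, RingHom.comp_apply, RingEquiv.toRingHom_eq_coe,
      RingHom.coe_coe, this, LinearEquiv.symm_apply_apply, RingEquiv.symm_apply_apply]
  · simp only [AddMonoidHom.coe_mk, ZeroHom.coe_mk, map_eq_zero_iff _ e.symm.injective,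
      map_eq_zero_iff _ b.equivFun.symm.injective] at hx
    exact hv (mulVec_injective_of_isUnit hu (by simpa using hx))

/-! ### Products that are not well-covered -/

section Pi

variable {ι : Type*} [DecidableEq ι] {A : ι → Type*} [∀ i, Ring (A i)] [Finite (∀ i, A i)]
-- The triples (0,1,0), (0,0,t), (1,1,t) pairwise agree in a coordinate, yet each `c` in `K` differs
-- from one of them everywhere: the third for `c = 0`, the second for `c = 1`, the first otherwise.
theorem not_isWellCovered_pi_of_three (r : ∀ i, FieldRetract K (A i))
    (h2 : ∀ i, ∀ x : A i, x + x = 0) {i j k : ι} (hij : i ≠ j) (hik : i ≠ k) (hjk : j ≠ k)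
    {t : K} (ht0 : t ≠ 0) (ht1 : t ≠ 1) : ¬(unitGraph (∀ i, A i)).IsWellCovered := by
  have hK2 : ∀ c : K, c + c = 0 := fun c => by
    rw [← (r i).ret_sec (c + c), map_add, h2, map_zero]
  have hne : ∀ (l : ι) (x y : ∀ i, A i), (r l).ret (x l) = (r l).ret (y l) → ¬IsUnit (x + y) :=
    fun l x y h hu => (r l).not_isUnit (x l + y l) (by rw [map_add, h, hK2])
      (hu.map (Pi.evalRingHom A l))
  refine not_isWellCovered (pi r i) (fun x => funext fun i => h2 i _)
    (I := {x | ((r i).ret (x i) = 0 ∧ (r j).ret (x j) = 1 ∧ (r k).ret (x k) = 0) ∨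
      ((r i).ret (x i) = 0 ∧ (r j).ret (x j) = 0 ∧ (r k).ret (x k) = t) ∨
      ((r i).ret (x i) = 1 ∧ (r j).ret (x j) = 1 ∧ (r k).ret (x k) = t)}) ?_ fun c => ?_
  · rintro x (⟨x1, x2, x3⟩ | ⟨x1, x2, x3⟩ | ⟨x1, x2, x3⟩) y
      (⟨y1, y2, y3⟩ | ⟨y1, y2, y3⟩ | ⟨y1, y2, y3⟩) _
    · exact hne i _ _ (x1.trans y1.symm)
    · exact hne i _ _ (x1.trans y1.symm)
    · exact hne j _ _ (x2.trans y2.symm)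
    · exact hne i _ _ (x1.trans y1.symm)
    · exact hne i _ _ (x1.trans y1.symm)
    · exact hne k _ _ (x3.trans y3.symm)
    · exact hne j _ _ (x2.trans y2.symm)
    · exact hne k _ _ (x3.trans y3.symm)
    · exact hne i _ _ (x1.trans y1.symm)
  · have key : ∀ a b d : K, a ≠ c → b ≠ c → d ≠ c → ∃ x : ∀ i, A i,
        (r i).ret (x i) = a ∧ (r j).ret (x j) = b ∧ (r k).ret (x k) = d ∧
          IsUnit (x + (pi r i).sec c) := by
      intro a b d ha hb hd
      -- The default `c + 1` differs from `c`, so the remaining factors do not obstruct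
      -- invertibility.
      let v : ι → K := fun l => if l = i then a else if l = j then b else if l = k then d else c + 1
      refine ⟨fun l => (r l).sec (v l), ?_, ?_, ?_, ?_⟩
      · simp [ret_sec, v]
      · simp [ret_sec, v, hij.symm]
      · simp [ret_sec, v, hik.symm, hjk.symm]
      · refine Pi.isUnit_iff.2 fun l => (r l).isUnit_add_sec_sec (h2 l) ?_
        simp only [v]
        split_ifs
        · exact ha
        · exact hb
        · exact hd
        · simp
    by_cases hc0 : c = 0
    · obtain ⟨x, h1, h3, h4, hu⟩ := key 1 1 t (by simp [hc0]) (by simp [hc0]) (by simpa [hc0])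
      exact ⟨x, Or.inr (Or.inr ⟨h1, h3, h4⟩), hu⟩
    by_cases hc1 : c = 1
    · obtain ⟨x, h1, h3, h4, hu⟩ := key 0 0 t (by simp [hc1]) (by simp [hc1]) (by simpa [hc1])
      exact ⟨x, Or.inr (Or.inl ⟨h1, h3, h4⟩), hu⟩
    · obtain ⟨x, h1, h3, h4, hu⟩ := key 0 1 0 (Ne.symm hc0) (Ne.symm hc1) (Ne.symm hc0)
      exact ⟨x, Or.inl ⟨h1, h3, h4⟩, hu⟩

/-- The blocking pairs are (0,1), (u,1), (w,0): the first two share their second coordinate, and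
`w`, `w + u` are nonunits. The pair (u,1) blocks `c = 0`, (w,0) blocks `c = 1`, and (0,1) blocks
every other `c`. -/
theorem not_isWellCovered_pi_of_two (r : ∀ i, FieldRetract K (A i))
    (h2 : ∀ i, ∀ x : A i, x + x = 0) {i j : ι} (hij : i ≠ j) {u w : A i} (hu : IsUnit u)
    (hw : ¬IsUnit w) (hwu : ¬IsUnit (w + u)) (hw1 : IsUnit (w + 1)) :
    ¬(unitGraph (∀ i, A i)).IsWellCovered := by
  have hK2 : ∀ c : K, c + c = 0 := fun c => by
    rw [← (r i).ret_sec (c + c), map_add, h2, map_zero]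
  have hni : ∀ x y : ∀ i, A i, ¬IsUnit (x i + y i) → ¬IsUnit (x + y) :=
    fun x y h hu => h (hu.map (Pi.evalRingHom A i))
  have hnj : ∀ x y : ∀ i, A i, (r j).ret (x j) = (r j).ret (y j) → ¬IsUnit (x + y) :=
    fun x y h hu => (r j).not_isUnit (x j + y j) (by rw [map_add, h, hK2])
      (hu.map (Pi.evalRingHom A j))
  refine not_isWellCovered (pi r i) (fun x => funext fun i => h2 i _)
    (I := {x | (x i = 0 ∧ (r j).ret (x j) = 1) ∨ (x i = u ∧ (r j).ret (x j) = 1) ∨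
      (x i = w ∧ (r j).ret (x j) = 0)}) ?_ fun c => ?_
  · rintro x (⟨x1, x2⟩ | ⟨x1, x2⟩ | ⟨x1, x2⟩) y (⟨y1, y2⟩ | ⟨y1, y2⟩ | ⟨y1, y2⟩) _
    · exact hnj _ _ (x2.trans y2.symm)
    · exact hnj _ _ (x2.trans y2.symm)
    · exact hni _ _ (by rwa [x1, y1, zero_add])
    · exact hnj _ _ (x2.trans y2.symm)
    · exact hnj _ _ (x2.trans y2.symm)
    · exact hni _ _ (by rwa [x1, y1, add_comm])
    · exact hni _ _ (by rwa [x1, y1, add_zero])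
    · exact hni _ _ (by rwa [x1, y1])
    · exact hnj _ _ (x2.trans y2.symm)
  · have key : ∀ (a : A i) (b : K), IsUnit (a + (r i).sec c) → b ≠ c → ∃ x : ∀ i, A i,
        x i = a ∧ (r j).ret (x j) = b ∧ IsUnit (x + (pi r i).sec c) := by
      intro a b ha hb
      let v : ι → K := fun l => if l = j then b else c + 1
      refine ⟨Function.update (fun l => (r l).sec (v l)) i a, by simp, ?_,
        Pi.isUnit_iff.2 fun l => ?_⟩
      · simp [hij.symm, ret_sec, v]
      · by_cases hl : l = i
        · subst hl
          rw [Pi.add_apply, Function.update_self]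
          exact ha
        · rw [Pi.add_apply, Function.update_of_ne hl]
          refine (r l).isUnit_add_sec_sec (h2 l) ?_
          simp only [v]
          split_ifs
          · exact hb
          · simp
    by_cases hc0 : c = 0
    · obtain ⟨x, h1, h3, h4⟩ := key u 1 (by simpa [hc0]) (by simp [hc0])
      exact ⟨x, Or.inr (Or.inl ⟨h1, h3⟩), h4⟩
    by_cases hc1 : c = 1
    · obtain ⟨x, h1, h3, h4⟩ := key w 0 (by simpa [hc1]) (by simp [hc1])
      exact ⟨x, Or.inr (Or.inr ⟨h1, h3⟩), h4⟩
    · obtain ⟨x, h1, h3, h4⟩ := key 0 1 (by simpa using (r i).isUnit_sec hc0) (Ne.symm hc1)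
      exact ⟨x, Or.inl ⟨h1, h3⟩, h4⟩

end Pi

end FieldRetract

/-! ### Rank-one perturbations and large matrix rings -/

section MatrixLemmas

variable {F : Type*} [Field F] {n : ℕ}

theorem isUnit_one_add_vecMulVec_iff (a l : Fin n → F) :
    IsUnit (1 + vecMulVec a l) ↔ 1 + l ⬝ᵥ a ≠ 0 := by
  rw [isUnit_iff_isUnit_det, isUnit_iff_ne_zero, vecMulVec_eq Unit,
    det_one_add_replicateCol_mul_replicateRow]

theorem isUnit_add_vecMulVec_iff {u : Matrix (Fin n) (Fin n) F} (hu : IsUnit u)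
    (a l : Fin n → F) : IsUnit (u + vecMulVec a l) ↔ 1 + l ⬝ᵥ (u⁻¹ *ᵥ a) ≠ 0 := by
  have hdet := (isUnit_iff_isUnit_det u).1 hu
  have : u + vecMulVec a l = u * (1 + vecMulVec (u⁻¹ *ᵥ a) l) := by
    rw [mul_add, mul_one, mul_vecMulVec, mulVec_mulVec, mul_nonsing_inv u hdet, one_mulVec]
  rw [this, ← isUnit_one_add_vecMulVec_iff, hu.mul_left_iff]

theorem exists_dotProduct_eq_one_and_ne_one {p q : Fin n → F} (hp : p ≠ 0) (hpq : p ≠ q) :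
    ∃ l : Fin n → F, l ⬝ᵥ p = 1 ∧ l ⬝ᵥ q ≠ 1 := by
  obtain ⟨i, hi⟩ := Function.ne_iff.1 hp
  obtain ⟨j, hj⟩ := Function.ne_iff.1 hpq
  rw [Pi.zero_apply] at hi
  let m : Fin n → F := Pi.single i (p i)⁻¹
  have hm : m ⬝ᵥ p = 1 := by simp [m, hi]
  by_cases hq : m ⬝ᵥ q = 1
  -- The correction vanishes on `p` and takes the value `q j - p j ≠ 0` on `q`.
  · refine ⟨m + (Pi.single j 1 - p j • m), ?_, ?_⟩
    · simp [add_dotProduct, sub_dotProduct, hm]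
    · simp [add_dotProduct, sub_dotProduct, hq, sub_eq_zero, Ne.symm hj]
  · exact ⟨m, hm, hq⟩

theorem not_isUnit_vecMulVec (hn : 2 ≤ n) (a l : Fin n → F) : ¬IsUnit (vecMulVec a l) := by
  intro hu
  have h := rank_of_isUnit _ hu
  have := rank_vecMulVec_le a l
  rw [Fintype.card_fin] at h
  omega

theorem not_isUnit_vecMulVec_add_vecMulVec (hn : 3 ≤ n) (a l b m : Fin n → F) :
    ¬IsUnit (vecMulVec a l + vecMulVec b m) := by
  intro hu
  have hmul : vecMulVec a l + vecMulVec b m = (of ![a, b])ᵀ * of ![l, m] := by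
    ext i j
    simp [vecMulVec_apply, mul_apply]
  have h := rank_of_isUnit _ hu
  have h1 := rank_mul_le_right (of ![a, b])ᵀ (of ![l, m])
  have h2 := rank_le_height (of ![l, m])
  rw [hmul, Fintype.card_fin] at h
  omega

/-- Take a unit `u` outside the embedded field, with all matrices `x` of rank at most one such that
`u + x` is singular. Sums of two such `x` have rank at most 2 < n. Here `u` blocks 0; for `c ≠ 0`
the inverses of `u` and `r.sec c` differ, so some `x` is singular against `u` but not against `r.sec
c`. -/
theorem not_isWellCovered_matrix_of_three_le [Finite F] (hF : ∀ x : F, x + x = 0) (hn : 3 ≤ n)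
    {K : Type*} [Field K] (r : FieldRetract K (Matrix (Fin n) (Fin n) F)) :
    ¬(unitGraph (Matrix (Fin n) (Fin n) F)).IsWellCovered := by
  have h2 : ∀ x : Matrix (Fin n) (Fin n) F, x + x = 0 := fun x => by ext; exact hF _
  have : NeZero n := ⟨by omega⟩
  let e₀ : Fin n → F := Pi.single ⟨0, by omega⟩ 1
  let e₁ : Fin n → F := Pi.single ⟨1, by omega⟩ 1
  have he₀ : e₀ ≠ 0 := by simp [e₀]
  have he₁ : e₁ ≠ 0 := by simp [e₁]
  let u : Matrix (Fin n) (Fin n) F := 1 + vecMulVec e₀ e₁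
  have hu : IsUnit u := (isUnit_one_add_vecMulVec_iff _ _).2 (by simp [e₀, e₁, Fin.ext_iff])
  -- Otherwise `u - 1`, nonzero of rank one, would lie in the embedded field and be invertible.
  have hus : ∀ c, u ≠ r.sec c := by
    intro c hc
    have h1 : vecMulVec e₀ e₁ = r.sec (c - 1) := by
      rw [map_sub, map_one, ← hc]
      simp [u]
    by_cases hc1 : c - 1 = 0
    · rw [hc1, map_zero] at h1
      have := congrFun (congrFun h1 ⟨0, by omega⟩) ⟨1, by omega⟩
      simp [vecMulVec_apply, e₀, e₁] at this
    · exact not_isUnit_vecMulVec (by omega) e₀ e₁ (h1 ▸ r.isUnit_sec hc1)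
  refine r.not_isWellCovered h2
    (I := {x | x = u ∨ ∃ a l, l ⬝ᵥ (u⁻¹ *ᵥ a) = 1 ∧ x = vecMulVec a l}) ?_ fun c => ?_
  · have hul : ∀ a l, l ⬝ᵥ (u⁻¹ *ᵥ a) = 1 → ¬IsUnit (u + vecMulVec a l) := by
      intro a l h
      rw [isUnit_add_vecMulVec_iff hu, h, hF]
      simp
    rintro x (rfl | ⟨a, l, h, rfl⟩) y (rfl | ⟨b, m, h', rfl⟩) hxy
    · exact absurd rfl hxy
    · exact hul _ _ h'
    · rw [add_comm]
      exact hul _ _ h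
    · exact not_isUnit_vecMulVec_add_vecMulVec hn _ _ _ _
  · by_cases hc : c = 0
    · exact ⟨u, Or.inl rfl, by simpa [hc] using hu⟩
    have hC := r.isUnit_sec hc
    have hCdet := (isUnit_iff_isUnit_det _).1 hC
    have hudet := (isUnit_iff_isUnit_det _).1 hu
    have hinv : u⁻¹ ≠ (r.sec c)⁻¹ := fun h => hus c (by
      rw [← nonsing_inv_nonsing_inv u hudet, h, nonsing_inv_nonsing_inv _ hCdet])
    obtain ⟨a, ha⟩ : ∃ a, u⁻¹ *ᵥ a ≠ (r.sec c)⁻¹ *ᵥ a := by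
      by_contra! h
      exact hinv (ext_of_mulVec_single fun i => h _)
    have hua : u⁻¹ *ᵥ a ≠ 0 := by
      intro h
      have h' := congrArg (u *ᵥ ·) h
      simp only [mulVec_mulVec, mul_nonsing_inv u hudet, one_mulVec, mulVec_zero] at h'
      simp [h'] at ha
    obtain ⟨l, hl1, hl2⟩ := exists_dotProduct_eq_one_and_ne_one hua ha
    refine ⟨vecMulVec a l, Or.inr ⟨a, l, hl1, rfl⟩, ?_⟩
    rw [add_comm, isUnit_add_vecMulVec_iff hC]
    exact fun h => hl2 (add_left_cancel (h.trans (hF 1).symm))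

/-- Over a field of characteristic two, square matrices of size at least two contain a unit `u` and
a nilpotent `w` with `w + u` singular. -/
theorem exists_unit_and_nilpotent (hF : ∀ x : F, x + x = 0) (hn : 2 ≤ n) :
    ∃ u w : Matrix (Fin n) (Fin n) F, IsUnit u ∧ ¬IsUnit w ∧ ¬IsUnit (w + u) ∧ IsUnit (w + 1) := by
  let i : Fin n := ⟨0, by omega⟩
  let j : Fin n := ⟨1, by omega⟩
  have hij : i ≠ j := by simp [i, j, Fin.ext_iff]
  -- Row `i` of both matrices is the `j`-th basis vector, so row `i` of their sum vanishes.
  refine ⟨(Equiv.swap i j).permMatrix F, vecMulVec (Pi.single i 1) (Pi.single j 1), ?_,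
    not_isUnit_vecMulVec hn _ _, fun h => ?_, ?_⟩
  · rw [isUnit_iff_isUnit_det, det_permutation]
    rcases Int.units_eq_one_or (Equiv.Perm.sign (Equiv.swap i j)) with h | h <;> simp [h]
  · rw [isUnit_iff_isUnit_det, isUnit_iff_ne_zero] at h
    refine h (det_eq_zero_of_row_eq_zero i fun k => ?_)
    by_cases hk : k = j
    · subst hk
      simp [vecMulVec_apply, Equiv.Perm.permMatrix, PEquiv.toMatrix_apply, hF]
    · simp [vecMulVec_apply, Equiv.Perm.permMatrix, PEquiv.toMatrix_apply, hk, Ne.symm hk]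
  · rw [add_comm, isUnit_one_add_vecMulVec_iff]
    simp [hij]

end MatrixLemmas

/-! ### Well-covered commutative cases -/

section WellCovered

theorem nonempty_of_maximal_isIndepSet {R : Type*} [Ring R] {M : Set R}
    (hM : Maximal (unitGraph R).IsIndepSet M) : M.Nonempty := by
  by_contra h
  rw [Set.not_nonempty_iff_eq_empty] at h
  subst h
  obtain ⟨x, hx, -⟩ := (unitGraph_maximal_isIndepSet_iff.1 hM).2 0 (by simp)
  exact hx

theorem isWellCovered_field {F : Type*} [Field F] [Finite F] (hF : ∀ x : F, x + x = 0) :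
    (unitGraph F).IsWellCovered := by
  rw [isWellCovered_iff_ncard]
  have key : ∀ M : Set F, Maximal (unitGraph F).IsIndepSet M → M.ncard = 1 := by
    intro M hM
    obtain ⟨m, hm⟩ := nonempty_of_maximal_isIndepSet hM
    rw [Set.ncard_eq_one]
    refine ⟨m, Set.eq_singleton_iff_unique_mem.2 ⟨hm, fun x hx => ?_⟩⟩
    by_contra hne
    refine unitGraph_isIndepSet_iff.1 hM.prop x hx m hm hne (IsUnit.mk0 _ fun h => hne ?_)
    exact add_right_cancel (h.trans (hF m).symm)
  intro M N hM hN
  rw [key M hM, key N hN]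

/-- Nonadjacent points share a row or a column of the grid; a set of points pairwise doing so lies
in a single line, so maximal ones are full lines. -/
theorem isWellCovered_prod_field {F : Type*} [Field F] [Finite F] (hF : ∀ x : F, x + x = 0) :
    (unitGraph (F × F)).IsWellCovered := by
  rw [isWellCovered_iff_ncard]
  have hu : ∀ x y : F × F, ¬IsUnit (x + y) ↔ x.1 = y.1 ∨ x.2 = y.2 := by
    intro x y
    have he : ∀ a b : F, a + b = 0 ↔ a = b := fun a b =>
      ⟨fun h => add_right_cancel (h.trans (hF b).symm), fun h => h ▸ hF a⟩
    rw [Prod.isUnit_iff, isUnit_iff_ne_zero, isUnit_iff_ne_zero, Prod.fst_add, Prod.snd_add,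
      Ne, Ne, he, he]
    tauto
  have key : ∀ M : Set (F × F), Maximal (unitGraph (F × F)).IsIndepSet M →
      M.ncard = Nat.card F := by
    intro M hM
    obtain ⟨m, hm⟩ := nonempty_of_maximal_isIndepSet hM
    have hind := unitGraph_isIndepSet_iff.1 hM.prop
    by_cases h : ∀ x ∈ M, x.1 = m.1
    · have : M = (fun b => (m.1, b)) '' Set.univ := by
        refine hM.eq_of_subset (unitGraph_isIndepSet_iff.2 ?_) fun x hx => ⟨x.2, trivial, ?_⟩
        · rintro _ ⟨b, -, rfl⟩ _ ⟨c, -, rfl⟩ _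
          exact (hu _ _).2 (Or.inl rfl)
        · rw [← h x hx]
      rw [this, Set.ncard_image_of_injective _ fun b c e => (Prod.ext_iff.1 e).2, Set.ncard_univ]
    · push Not at h
      obtain ⟨m', hm', hne⟩ := h
      have hor : ∀ x ∈ M, ∀ y ∈ M, x.1 = y.1 ∨ x.2 = y.2 := fun x hx y hy => by
        by_cases e : x = y
        · exact Or.inl (e ▸ rfl)
        · exact (hu _ _).1 (hind x hx y hy e)
      have h2 : ∀ x ∈ M, x.2 = m.2 := by
        intro x hx
        have h3 := (hor m' hm' m hm).resolve_left hne
        rcases hor x hx m hm with h1 | h1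
        · rcases hor x hx m' hm' with h4 | h4
          · exact absurd (h4.symm.trans h1) hne
          · exact h4.trans h3
        · exact h1
      have : M = (fun b => (b, m.2)) '' Set.univ := by
        refine hM.eq_of_subset (unitGraph_isIndepSet_iff.2 ?_) fun x hx => ⟨x.1, trivial, ?_⟩
        · rintro _ ⟨b, -, rfl⟩ _ ⟨c, -, rfl⟩ _
          exact (hu _ _).2 (Or.inr rfl)
        · rw [← h2 x hx]
      rw [this, Set.ncard_image_of_injective _ fun b c e => (Prod.ext_iff.1 e).1, Set.ncard_univ]
  intro M N hM hN
  rw [key M hM, key N hN]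

/-- A ring of characteristic two whose only unit is `1` has well-covered unit graph. -/
theorem isWellCovered_of_isUnit_iff_eq_one {S : Type*} [Ring S] [Finite S] [Nontrivial S]
    (h2 : ∀ x : S, x + x = 0) (h1 : ∀ x : S, IsUnit x ↔ x = 1) :
    (unitGraph S).IsWellCovered := by
  rw [isWellCovered_iff_ncard]
  have hadd : ∀ x y : S, x + y = 1 ↔ x = y + 1 := fun x y =>
    ⟨fun h => by rw [← h, add_comm x y, ← add_assoc, h2, zero_add],
      fun h => by rw [h, add_right_comm, h2, zero_add]⟩
  have key : ∀ M : Set S, Maximal (unitGraph S).IsIndepSet M → M.ncard + M.ncard = Nat.card S := by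
    intro M hM
    obtain ⟨hi, hm⟩ := unitGraph_maximal_isIndepSet_iff.1 hM
    -- The only neighbour of `y` is `y + 1`: the graph is a perfect matching, and `M` takes one end
    -- of each edge.
    have hcompl : Mᶜ = (· + 1) '' M := by
      ext y
      constructor
      · intro hy
        obtain ⟨x, hx, hu⟩ := hm y hy
        rw [h1, add_comm, hadd] at hu
        exact ⟨x, hx, hu.symm⟩
      · rintro ⟨x, hx, rfl⟩ hy
        refine hi _ hy x hx (by simp) ?_
        rw [h1, hadd]
    have hc : Mᶜ.ncard = M.ncard := by
      rw [hcompl, Set.ncard_image_of_injective _ (add_left_injective 1)]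
    have := Set.ncard_add_ncard_compl M
    rwa [hc] at this
  intro M N hM hN
  have := key M hM
  have := key N hN
  omega

theorem isWellCovered_pi_zmod_two {k : ℕ} (hk : 1 ≤ k) :
    (unitGraph (Fin k → ZMod 2)).IsWellCovered := by
  have : Nonempty (Fin k) := ⟨⟨0, hk⟩⟩
  refine isWellCovered_of_isUnit_iff_eq_one (fun x => funext fun i => ?_) fun x => ?_
  · exact CharTwo.add_self_eq_zero (x i)
  · have : ∀ a : ZMod 2, IsUnit a ↔ a = 1 := by
      intro a
      rw [isUnit_iff_ne_zero]
      revert a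
      decide
    rw [Pi.isUnit_iff, funext_iff]
    exact forall_congr' fun i => this (x i)

end WellCovered

/-! ### Two-by-two matrices -/

section TwoByTwo

variable {F : Type*} [Field F]

theorem exists_eq_vecMulVec_of_det_eq_zero (z : Matrix (Fin 2) (Fin 2) F) (hz : z.det = 0) :
    ∃ b μ : Fin 2 → F, z = vecMulVec b μ := by
  rw [det_fin_two] at hz
  by_cases h0 : z 0 0 = 0
  · by_cases h1 : z 0 1 = 0
    · refine ⟨![0, 1], z 1, ?_⟩
      ext i j
      fin_cases i <;> fin_cases j <;> simp [vecMulVec_apply, h0, h1]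
    · have h2 : z 1 0 = 0 := by simpa [h0, h1] using hz
      refine ⟨![1, z 1 1 / z 0 1], z 0, ?_⟩
      ext i j
      fin_cases i <;> fin_cases j <;> simp [vecMulVec_apply, h0, h1, h2]
  · refine ⟨![1, z 1 0 / z 0 0], z 0, ?_⟩
    have h1 : z 1 1 = z 1 0 / z 0 0 * z 0 1 := by
      field_simp
      linear_combination hz
    ext i j
    fin_cases i <;> fin_cases j <;> simp [vecMulVec_apply, h0, h1]

/-- The factorization shows that the sum is singular exactly when the columns `a`, `b` or the rows
`l`, `m` are parallel, which is the analogue of sharing a grid line. -/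
theorem det_vecMulVec_add_vecMulVec (a l b m : Fin 2 → F) :
    (vecMulVec a l + vecMulVec b m).det =
      (a 0 * b 1 - a 1 * b 0) * (l 0 * m 1 - l 1 * m 0) := by
  simp only [det_fin_two, Matrix.add_apply, vecMulVec_apply]
  ring

theorem exists_smul_eq_of_cross_eq_zero {a b : Fin 2 → F} (ha : a ≠ 0)
    (h : a 0 * b 1 - a 1 * b 0 = 0) : ∃ s : F, b = s • a := by
  by_cases h0 : a 0 = 0
  · have h1 : a 1 ≠ 0 := fun h1 => ha (by ext i; fin_cases i <;> simp [h0, h1])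
    have h2 : b 0 = 0 := by simpa [h0, h1] using h
    refine ⟨b 1 / a 1, ?_⟩
    ext i
    fin_cases i <;> simp [h0, h1, h2]
  · refine ⟨b 0 / a 0, ?_⟩
    have h1 : b 1 = b 0 / a 0 * a 1 := by
      field_simp
      linear_combination h
    ext i
    fin_cases i <;> simp [h0, h1]

theorem cross_eq_zero_trans {a b c : Fin 2 → F} (hb : b ≠ 0)
    (hab : a 0 * b 1 - a 1 * b 0 = 0) (hbc : b 0 * c 1 - b 1 * c 0 = 0) :
    a 0 * c 1 - a 1 * c 0 = 0 := by
  obtain ⟨s, rfl⟩ := exists_smul_eq_of_cross_eq_zero hb hbc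
  simp only [Pi.smul_apply, smul_eq_mul]
  linear_combination s * hab

theorem vecMulVec_right_injective {a : Fin 2 → F} (ha : a ≠ 0) :
    Function.Injective fun μ : Fin 2 → F => vecMulVec a μ := by
  intro μ ν h
  obtain ⟨i, hi⟩ := Function.ne_iff.1 ha
  ext j
  have := congrFun (congrFun h i) j
  simpa [vecMulVec_apply, show a i ≠ 0 from hi] using this

theorem vecMulVec_left_injective {l : Fin 2 → F} (hl : l ≠ 0) :
    Function.Injective fun b : Fin 2 → F => vecMulVec b l := by
  intro μ ν h
  obtain ⟨j, hj⟩ := Function.ne_iff.1 hl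
  ext i
  have := congrFun (congrFun h i) j
  simpa [vecMulVec_apply, show l j ≠ 0 from hj] using this

/-- Translated by a member `m`, all members have rank at most one and pairwise share a column or a
row direction. As in the grid, one direction is common to all, so by maximality the set is a
translate of all matrices with that column or row direction, a plane over `F`. -/
theorem isWellCovered_matrix_two [Finite F] (hF : ∀ x : F, x + x = 0) :
    (unitGraph (Matrix (Fin 2) (Fin 2) F)).IsWellCovered := by
  rw [isWellCovered_iff_ncard]
  have h2 : ∀ x : Matrix (Fin 2) (Fin 2) F, x + x = 0 := fun x => by ext; exact hF _
  have hsing : ∀ x : Matrix (Fin 2) (Fin 2) F, ¬IsUnit x ↔ x.det = 0 := fun x => by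
    rw [isUnit_iff_isUnit_det, isUnit_iff_ne_zero, not_not]
  have hcancel : ∀ x y m : Matrix (Fin 2) (Fin 2) F, (x + m) + (y + m) = x + y := fun x y m => by
    rw [add_add_add_comm, h2, add_zero]
  have hdet : ∀ b μ : Fin 2 → F, (vecMulVec b μ).det = 0 := fun b μ => by
    simp only [det_fin_two, vecMulVec_apply]
    ring
  have key : ∀ M : Set (Matrix (Fin 2) (Fin 2) F),
      Maximal (unitGraph (Matrix (Fin 2) (Fin 2) F)).IsIndepSet M →
        M.ncard = Nat.card (Fin 2 → F) := by
    intro M hM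
    obtain ⟨m, hm⟩ := nonempty_of_maximal_isIndepSet hM
    have hind : ∀ x ∈ M, ∀ y ∈ M, (x + y).det = 0 := fun x hx y hy => by
      by_cases e : x = y
      · rw [e, h2, det_zero]
      · exact (hsing _).1 (unitGraph_isIndepSet_iff.1 hM.prop x hx y hy e)
    have hrep : ∀ x ∈ M, ∃ b μ, x = vecMulVec b μ + m := by
      intro x hx
      obtain ⟨b, μ, h⟩ := exists_eq_vecMulVec_of_det_eq_zero _ (hind x hx m hm)
      exact ⟨b, μ, by rw [← h, add_assoc, h2, add_zero]⟩
    have hleft : ∀ a : Fin 2 → F, a ≠ 0 → (∀ z ∈ M, ∃ μ, z = vecMulVec a μ + m) →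
        M.ncard = Nat.card (Fin 2 → F) := by
      intro a ha h
      have : M = (fun μ => vecMulVec a μ + m) '' Set.univ := by
        refine hM.eq_of_subset (unitGraph_isIndepSet_iff.2 ?_) fun x hx => ?_
        · rintro _ ⟨b, -, rfl⟩ _ ⟨c, -, rfl⟩ _
          rw [hsing, hcancel, ← vecMulVec_add, hdet]
        · obtain ⟨μ, rfl⟩ := h x hx
          exact ⟨μ, trivial, rfl⟩
      have hinj := (add_left_injective m).comp (vecMulVec_right_injective ha)
      exact this ▸ (Set.ncard_image_of_injective _ hinj).trans (Set.ncard_univ _)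
    have hright : ∀ l : Fin 2 → F, l ≠ 0 → (∀ z ∈ M, ∃ b, z = vecMulVec b l + m) →
        M.ncard = Nat.card (Fin 2 → F) := by
      intro l hl h
      have : M = (fun b => vecMulVec b l + m) '' Set.univ := by
        refine hM.eq_of_subset (unitGraph_isIndepSet_iff.2 ?_) fun x hx => ?_
        · rintro _ ⟨b, -, rfl⟩ _ ⟨c, -, rfl⟩ _
          rw [hsing, hcancel, ← add_vecMulVec, hdet]
        · obtain ⟨b, rfl⟩ := h x hx
          exact ⟨b, trivial, rfl⟩
      have hinj := (add_left_injective m).comp (vecMulVec_left_injective hl)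
      exact this ▸ (Set.ncard_image_of_injective _ hinj).trans (Set.ncard_univ _)
    by_cases hall : ∀ z ∈ M, z = m
    · exact hleft (Pi.single 0 1) (by simp) fun z hz => ⟨0, by simp [hall z hz]⟩
    push Not at hall
    obtain ⟨x, hx, hxm⟩ := hall
    obtain ⟨a, l, rfl⟩ := hrep x hx
    have ha : a ≠ 0 := by rintro rfl; simp at hxm
    have hl : l ≠ 0 := by rintro rfl; simp at hxm
    by_cases H : ∀ z ∈ M, ∃ μ, z = vecMulVec a μ + m
    · exact hleft a ha H
    push Not at H
    obtain ⟨y, hy, hy'⟩ := H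
    obtain ⟨b, μ, rfl⟩ := hrep y hy
    have hb : b ≠ 0 := by rintro rfl; exact hy' 0 (by simp)
    have hμ : μ ≠ 0 := by rintro rfl; exact hy' 0 (by simp)
    have hab : a 0 * b 1 - a 1 * b 0 ≠ 0 := by
      intro h
      obtain ⟨s, rfl⟩ := exists_smul_eq_of_cross_eq_zero ha h
      exact hy' (s • μ) (by rw [smul_vecMulVec, vecMulVec_smul])
    have hcross : ∀ {c ν d ξ : Fin 2 → F}, vecMulVec c ν + m ∈ M → vecMulVec d ξ + m ∈ M →
        c 0 * d 1 - c 1 * d 0 = 0 ∨ ν 0 * ξ 1 - ν 1 * ξ 0 = 0 := by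
      intro c ν d ξ h h'
      have := hind _ h _ h'
      rwa [hcancel, det_vecMulVec_add_vecMulVec, mul_eq_zero] at this
    have hlμ := (hcross hx hy).resolve_left hab
    refine hright l hl fun z hz => ?_
    obtain ⟨d, ν, rfl⟩ := hrep z hz
    by_cases hd : d = 0
    · exact ⟨0, by simp [hd]⟩
    -- The column `d` cannot be parallel to both `a` and `b`, so `ν` is parallel to `l` or to `μ`,
    -- hence to `l`.
    have hlν : l 0 * ν 1 - l 1 * ν 0 = 0 := by
      refine (hcross hx hz).elim (fun had => ?_) id
      rcases hcross hy hz with hbd | hμν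
      · refine absurd (cross_eq_zero_trans hd had ?_) hab
        linear_combination -hbd
      · exact cross_eq_zero_trans hμ hlμ hμν
    obtain ⟨s, rfl⟩ := exists_smul_eq_of_cross_eq_zero hl hlν
    exact ⟨s • d, by rw [smul_vecMulVec, vecMulVec_smul]⟩
  intro M N hM hN
  rw [key M hM, key N hN]

end TwoByTwo

/-! ### Semisimple structure and equality of the field orders -/

section Structure

theorem two_eq_zero_iff_two_dvd_card {F : Type*} [Field F] [Finite F] :
    (2 : F) = 0 ↔ 2 ∣ Nat.card F := by
  have := Fintype.ofFinite F
  rw [Nat.card_eq_fintype_card, Nat.dvd_iff_mod_eq_zero, ← FiniteField.even_card_iff_char_two]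
  constructor
  · intro h
    have h1 : ringChar F ∣ 2 := ringChar.dvd (by exact_mod_cast h)
    exact ((Nat.dvd_prime Nat.prime_two).1 h1).resolve_left CharP.ringChar_ne_one
  · intro h
    have := ringChar.Nat.cast_ringChar (R := F)
    rw [h] at this
    exact_mod_cast this

theorem charP_two_of_two_eq_zero {F : Type*} [Field F] (h : (2 : F) = 0) : CharP F 2 :=
  CharTwo.of_one_ne_zero_of_two_eq_zero one_ne_zero h

theorem exists_field_card_eq_pow (F : Type*) [Field F] [Finite F] (n : ℕ) [NeZero n] :
    ∃ (K : Type) (_ : Field K), Nat.card K = Nat.card F ^ n := by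
  obtain ⟨p, hp⟩ := CharP.exists F
  have : Fact p.Prime := ⟨CharP.char_is_prime F p⟩
  exact ⟨FiniteField.Extension F p n, inferInstance, FiniteField.natCard_extension F p n⟩

theorem exists_ringEquiv_pi_matrix_field (S : Type u) [Ring S] [Finite S] [IsSemisimpleRing S] :
    ∃ (n : ℕ) (D : Fin n → Type u) (d : Fin n → ℕ) (_ : ∀ i, Field (D i)),
      (∀ i, Finite (D i)) ∧ (∀ i, NeZero (d i)) ∧
        Nonempty (S ≃+* Π i, Matrix (Fin (d i)) (Fin (d i)) (D i)) := by
  obtain ⟨n, D, d, _, hd, ⟨e⟩⟩ := IsSemisimpleRing.exists_ringEquiv_pi_matrix_divisionRing S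
  have hfin : ∀ i, Finite (D i) := fun i => by
    have := hd i
    refine Finite.of_surjective (fun s => e s i 0 0) fun x => ?_
    exact ⟨e.symm fun j => of fun _ _ => if h : j = i then h ▸ x else 0, by simp⟩
  exact ⟨n, D, d, fun i => littleWedderburn (D i), hfin, hd, ⟨e⟩⟩

/-- The kernels of the retractions of the factors of a product all have the same size in a
ring with well-covered unit graph. -/
theorem card_eq_card_of_isWellCovered {R ι : Type*} [DecidableEq ι] {A K : ι → Type*} [Ring R]
    [Finite R] [∀ i, Ring (A i)] [∀ i, Field (K i)] (f : R →+* ∀ i, A i)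
    (hf : Function.Surjective f) [IsLocalHom f] (r : ∀ i, FieldRetract (K i) (A i))
    (hR : (unitGraph R).IsWellCovered) (i j : ι) : Nat.card (K i) = Nat.card (K j) := by
  let g (l : ι) : R →+ K l :=
    ((r l).ret.comp (Pi.evalAddMonoidHom A l)).comp f.toAddMonoidHom
  have hg : ∀ l x, g l x = (r l).ret (f x l) := fun _ _ => rfl
  have hsurj : ∀ l, Function.Surjective (g l) := fun l c => by
    obtain ⟨x, hx⟩ := hf fun m => if h : m = l then (r m).sec (h ▸ c) else 0
    exact ⟨x, by rw [hg, hx]; simp [(r l).ret_sec]⟩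
  have hmax : ∀ l, Maximal (unitGraph R).IsIndepSet ((g l).ker : Set R) := by
    intro l
    refine maximal_isIndepSet_addSubgroup _ (fun x hx hu => ?_) fun y hy => ?_
    · exact (r l).not_isUnit _ hx ((hu.map f).map (Pi.evalRingHom A l))
    -- This unit has the same retraction value as `f y` in factor `l`, so a lift of `v - f y` lies
    -- in the kernel and is adjacent to `y`.
    · let v : ∀ m, A m := Function.update 1 l ((r l).sec (g l y))
      have hv : IsUnit v := Pi.isUnit_iff.2 fun m => by
        by_cases h : m = l
        · subst h
          simpa [v] using (r m).isUnit_sec hy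
        · simp [v, h]
      obtain ⟨x, hx⟩ := hf (v - f y)
      refine ⟨x, ?_, ?_⟩
      · change g l x = 0
        rw [hg, hx, Pi.sub_apply, map_sub, ← hg]
        simp [v, (r l).ret_sec]
      · rwa [← isUnit_map_iff f, map_add, hx, sub_add_cancel]
  have hcard : ∀ l, ((g l).ker : Set R).ncard * Nat.card (K l) = Nat.card R := by
    intro l
    rw [← Nat.card_coe_set_eq, mul_comm, ← Nat.card_congr
      (QuotientAddGroup.quotientKerEquivOfSurjective (g l) (hsurj l)).toEquiv]
    exact (AddSubgroup.card_eq_card_quotient_mul_card_addSubgroup _).symm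
  have h := isWellCovered_iff_ncard.1 hR _ _ (hmax i) (hmax j)
  have hi := hcard i
  rw [← hcard j, h] at hi
  refine Nat.eq_of_mul_eq_mul_left ?_ hi
  exact (Set.ncard_pos (Set.toFinite _)).2 (nonempty_of_maximal_isIndepSet (hmax j))

theorem nonempty_ringEquiv_of_card_eq {F K : Type*} [Field F] [Finite F] [Field K] [Finite K]
    (h : Nat.card F = Nat.card K) : Nonempty (F ≃+* K) := by
  have := Fintype.ofFinite F
  have := Fintype.ofFinite K
  exact ⟨FiniteField.ringEquivOfCardEq (by rwa [Fintype.card_eq_nat_card, Fintype.card_eq_nat_card])⟩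

theorem nonempty_matrix_ringEquiv_of_eq_one {F : Type*} [Field F] {d : ℕ} (hd : d = 1) :
    Nonempty (Matrix (Fin d) (Fin d) F ≃+* F) := by
  subst hd
  exact ⟨uniqueRingEquiv⟩

theorem exists_ne_zero_ne_one {K : Type*} [Field K] [Finite K] (h : Nat.card K ≠ 2) :
    ∃ t : K, t ≠ 0 ∧ t ≠ 1 := by
  by_contra! hc
  refine h ?_
  rw [← Set.ncard_univ, show (Set.univ : Set K) = {0, 1} from ?_, Set.ncard_pair zero_ne_one]
  ext t
  simpa [or_iff_not_imp_left] using hc t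

end Structure

/-! ### Assembling the classification -/

section Classification

theorem RingEquiv.isLocalHom_toRingHom_of_ring {S T : Type*} [Ring S] [Ring T] (e : S ≃+* T) :
    IsLocalHom e.toRingHom :=
  ⟨fun x hx => by
    have h : IsUnit (e.symm (e x)) := IsUnit.map e.symm hx
    rwa [e.symm_apply_apply] at h⟩

variable {R : Type u} [Ring R] [Nontrivial R] [Finite R]

theorem exists_ringEquiv_of_isWellCovered (hR : (unitGraph R).IsWellCovered) :
    (∃ (F : Type u) (_ : Field F) (_ : Finite F) (_ : CharP F 2),
        Nonempty ((R ⧸ Ring.jacobson R) ≃+* F) ∨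
        Nonempty ((R ⧸ Ring.jacobson R) ≃+* F × F) ∨
        Nonempty ((R ⧸ Ring.jacobson R) ≃+* Matrix (Fin 2) (Fin 2) F)) ∨
      (∃ k : ℕ, 1 ≤ k ∧ Nonempty ((R ⧸ Ring.jacobson R) ≃+* (Fin k → ZMod 2))) := by
  have hloc : IsLocalHom (Ideal.Quotient.mk (Ring.jacobson R)) := isLocalHom_mk_jacobson
  have : Nontrivial (R ⧸ Ring.jacobson R) :=
    Ideal.Quotient.nontrivial_iff.2 (Ring.jacobson_lt_top R).ne
  have : Finite (R ⧸ Ring.jacobson R) := Finite.of_surjective _ Ideal.Quotient.mk_surjective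
  obtain ⟨n, D, d, _, hD, hd, ⟨e⟩⟩ := exists_ringEquiv_pi_matrix_field (R ⧸ Ring.jacobson R)
  let f := e.toRingHom.comp (Ideal.Quotient.mk (Ring.jacobson R))
  have hf : Function.Surjective f := e.surjective.comp Ideal.Quotient.mk_surjective
  have := RingEquiv.isLocalHom_toRingHom_of_ring e
  have : IsLocalHom f := RingHom.isLocalHom_comp _ _
  have hS : Nontrivial (Π i, Matrix (Fin (d i)) (Fin (d i)) (D i)) := e.injective.nontrivial
  choose K hKfield hK using fun i => exists_field_card_eq_pow (D i) (d i)
  have hcards : ∀ i j, Nat.card (K i) = Nat.card (K j) :=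
    card_eq_card_of_isWellCovered f hf
      (fun i => (FieldRetract.nonempty_matrix (hK i)).some) hR
  obtain ⟨i₀, hi₀⟩ : ∃ i, (2 : D i) = 0 := by
    by_contra! hne
    refine not_isWellCovered_of_isUnit_two ((isUnit_map_iff f _).1 ?_) hR
    rw [map_ofNat]
    refine Pi.isUnit_iff.2 fun i => ?_
    have := (IsUnit.mk0 _ (hne i)).map (scalar (Fin (d i)))
    rwa [map_ofNat] at this
  -- Characteristic 2 is parity of the order, and the orders `|D i| ^ d i` all coincide.
  have hD2 : ∀ i, (2 : D i) = 0 := fun i => by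
    rw [two_eq_zero_iff_two_dvd_card] at hi₀ ⊢
    refine Nat.prime_two.dvd_of_dvd_pow (n := d i) ?_
    rw [← hK i, hcards i i₀, hK i₀]
    exact dvd_pow hi₀ (NeZero.ne _)
  have hDadd : ∀ i, ∀ x : D i, x + x = 0 := fun i x => by rw [← two_mul, hD2, zero_mul]
  have hadd : ∀ i, ∀ x : Matrix (Fin (d i)) (Fin (d i)) (D i), x + x = 0 :=
    fun i x => by ext; exact hDadd i _
  have hW := (isWellCovered_iff_of_surjective f hf (fun x => funext fun i => hadd i _)).1 hR
  have : Finite (K i₀) := Nat.finite_of_card_ne_zero (hK i₀ ▸ pow_ne_zero _ Nat.card_pos.ne')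
  -- A retract needs only the order of the field, so one field serves all factors and embeds
  -- diagonally.
  let r : ∀ i, FieldRetract (K i₀) (Matrix (Fin (d i)) (Fin (d i)) (D i)) := fun i =>
    (FieldRetract.nonempty_matrix ((hcards i₀ i).trans (hK i))).some
  by_cases hd1 : ∀ i, d i = 1
  · have hKD : ∀ i, Nat.card (D i) = Nat.card (K i₀) := fun i => by
      rw [hcards i₀ i, hK i, hd1 i, pow_one]
    have e₁ : ∀ i, Matrix (Fin (d i)) (Fin (d i)) (D i) ≃+* D i := fun i =>
      (nonempty_matrix_ringEquiv_of_eq_one (hd1 i)).some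
    by_cases hq : Nat.card (K i₀) = 2
    · refine Or.inr ⟨n, i₀.pos, ⟨e.trans (RingEquiv.piCongrRight fun i => (e₁ i).trans ?_)⟩⟩
      exact (nonempty_ringEquiv_of_card_eq (by rw [hKD, hq, Nat.card_zmod])).some
    · have hn : n < 3 := by
        by_contra! hn
        obtain ⟨t, ht0, ht1⟩ := exists_ne_zero_ne_one hq
        exact FieldRetract.not_isWellCovered_pi_of_three r hadd (i := ⟨0, by omega⟩)
          (j := ⟨1, by omega⟩) (k := ⟨2, by omega⟩) (by simp) (by simp) (by simp) ht0 ht1 hW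
      refine Or.inl ⟨D i₀, inferInstance, hD i₀, charP_two_of_two_eq_zero hi₀, ?_⟩
      have e₂ : ∀ i, Matrix (Fin (d i)) (Fin (d i)) (D i) ≃+* D i₀ := fun i =>
        (e₁ i).trans (nonempty_ringEquiv_of_card_eq ((hKD i).trans (hKD i₀).symm)).some
      have hn0 := i₀.pos
      obtain rfl | rfl : n = 1 ∨ n = 2 := by omega
      · exact Or.inl ⟨(e.trans (RingEquiv.piUnique _)).trans (e₂ _)⟩
      · exact Or.inr (Or.inl ⟨(e.trans (RingEquiv.piFinTwo _)).trans
          (RingEquiv.prodCongr (e₂ 0) (e₂ 1))⟩)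
  · push Not at hd1
    obtain ⟨i, hi⟩ := hd1
    have hi2 : 2 ≤ d i := by
      have := NeZero.ne (d i)
      omega
    have huniq : ∀ j, j = i := by
      intro j
      by_contra hj
      obtain ⟨u, w, hu, hw, hwu, hw1⟩ := exists_unit_and_nilpotent (hDadd i) hi2
      exact FieldRetract.not_isWellCovered_pi_of_two r hadd (Ne.symm hj) hu hw hwu hw1 hW
    let _ : Unique (Fin n) := ⟨⟨i⟩, huniq⟩
    let e₁ : (Π i, Matrix (Fin (d i)) (Fin (d i)) (D i)) ≃+* Matrix (Fin (d i)) (Fin (d i)) (D i) :=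
      RingEquiv.piUnique _
    have := RingEquiv.isLocalHom_toRingHom_of_ring e₁
    have hWi := (isWellCovered_iff_of_surjective e₁.toRingHom e₁.surjective (hadd i)).1 hW
    have hi3 : d i = 2 := by
      refine le_antisymm (not_lt.1 fun h3 => ?_) hi2
      exact not_isWellCovered_matrix_of_three_le (hDadd i) h3 (r i) hWi
    exact Or.inl ⟨D i, inferInstance, hD i, charP_two_of_two_eq_zero (hD2 i), Or.inr (Or.inr
      ⟨(e.trans e₁).trans (reindexAlgEquiv ℕ (D i) (finCongr hi3)).toRingEquiv⟩)⟩

theorem isWellCovered_of_ringEquiv {T : Type*} [Ring T] (e : (R ⧸ Ring.jacobson R) ≃+* T)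
    (h2 : ∀ x : T, x + x = 0) (hT : (unitGraph T).IsWellCovered) :
    (unitGraph R).IsWellCovered := by
  have hloc : IsLocalHom (Ideal.Quotient.mk (Ring.jacobson R)) := isLocalHom_mk_jacobson
  have : Nontrivial (R ⧸ Ring.jacobson R) :=
    Ideal.Quotient.nontrivial_iff.2 (Ring.jacobson_lt_top R).ne
  have : Nontrivial T := e.injective.nontrivial
  have := RingEquiv.isLocalHom_toRingHom_of_ring e
  have : IsLocalHom (e.toRingHom.comp (Ideal.Quotient.mk (Ring.jacobson R))) :=
    RingHom.isLocalHom_comp _ _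
  exact (isWellCovered_iff_of_surjective
    (e.toRingHom.comp (Ideal.Quotient.mk (Ring.jacobson R)))
    (e.surjective.comp Ideal.Quotient.mk_surjective) h2).2 hT

end Classification

theorem mainTheorem2 {R : Type u} [Ring R] [Nontrivial R] [Finite R] :
    (unitGraph R).IsWellCovered ↔
      (∃ (F : Type u) (_ : Field F) (_ : Finite F) (_ : CharP F 2),
        Nonempty ((R ⧸ Ring.jacobson R) ≃+* F) ∨
        Nonempty ((R ⧸ Ring.jacobson R) ≃+* F × F) ∨
        Nonempty ((R ⧸ Ring.jacobson R) ≃+* Matrix (Fin 2) (Fin 2) F)) ∨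
      (∃ k : ℕ, 1 ≤ k ∧ Nonempty ((R ⧸ Ring.jacobson R) ≃+* (Fin k → ZMod 2))) := by
  refine ⟨exists_ringEquiv_of_isWellCovered, ?_⟩
  rintro (⟨F, _, _, _, h⟩ | ⟨k, hk, ⟨e⟩⟩)
  · have hF : ∀ x : F, x + x = 0 := CharTwo.add_self_eq_zero
    rcases h with ⟨⟨e⟩⟩ | ⟨⟨e⟩⟩ | ⟨⟨e⟩⟩
    · exact isWellCovered_of_ringEquiv e hF (isWellCovered_field hF)
    · exact isWellCovered_of_ringEquiv e (fun x => Prod.ext (hF _) (hF _))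
        (isWellCovered_prod_field hF)
    · exact isWellCovered_of_ringEquiv e (fun x => by ext; exact hF _)
        (isWellCovered_matrix_two hF)
  · exact isWellCovered_of_ringEquiv e (fun x => funext fun i => CharTwo.add_self_eq_zero (x i))
      (isWellCovered_pi_zmod_two hk)
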